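/- All groups are finite. For a group $G$ with center $Z(G)$, let $\mathrm{Cent}(G)=\{C_G(x) : x\in G\}$ and $2\text{-}\mathrm{Cent}(G)=\{C_G(\{x,y\}) : x,y\in G,\ x\neq y\}$, where $C_G(A)$ denotes the centralizer in $G$ of the subset $A\subseteq G$. The group $G$ is called $n$-centralizer if $|\mathrm{Cent}(G)|=n$, it is called $(2,n)$-centralizer if $|2\text{-}\mathrm{Cent}(G)|=n$, and it is called primitive $(2,n)$-centralizer if $|2\text{-}\mathrm{Cent}(G)|=|2\text{-}\mathrm{Cent}(G/Z(G))|=n$. Let $D_{14}$ be the dihedral group of order $14$ and let $\mathrm{Hol}(\mathbb{Z}_7)=\mathbb{Z}_7\rtimes\mathrm{Aut}(\mathbb{Z}_7)$ be the holomorph of the cyclic group of order $7$. **Theorem.** Let $G$ be a finite group. Then $G$ is $(2,9)$-centralizer if and only if $G\cong D_{14}$, or $G\cong \mathrm{Hol}(\mathbb{Z}_7)$, or $G$ is a non-abelian group of order $21$, or $G$ is an $8$-centralizer group with non-trivial center. Moreover, $G$ is primitive $(2,9)$-centralizer if and only if $G\cong D_{14}$, or $G\cong \mathrm{Hol}(\mathbb{Z}_7)$,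 or $G$ is a non-abelian group of order $21$. -/

import Mathlib

/-- `Cent(G)`: the set of centralizers of single elements of `G`. -/
def elementCentralizers (G : Type*) [Group G] : Set (Subgroup G) :=
  {H | ∃ x : G, H = Subgroup.centralizer {x}}

/-- `2-Cent(G)`: the set of centralizers of two-element subsets of `G`. -/
def twoElementCentralizers (G : Type*) [Group G] : Set (Subgroup G) :=
  {H | ∃ x y : G, x ≠ y ∧ H = Subgroup.centralizer {x, y}}

/-- `G` is `n`-centralizer: `|Cent(G)| = n` (used for finite `G`). -/
def IsNCentralizer (n : ℕ) (G : Type*) [Group G] : Prop :=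
  (elementCentralizers G).ncard = n

/-- `G` is `(2,n)`-centralizer: `|2-Cent(G)| = n` (used for finite `G`). -/
def IsTwoNCentralizer (n : ℕ) (G : Type*) [Group G] : Prop :=
  (twoElementCentralizers G).ncard = n

/-- `G` is primitive `(2,n)`-centralizer: `|2-Cent(G)| = |2-Cent(G/Z(G))| = n`. -/
def IsPrimitiveTwoNCentralizer (n : ℕ) (G : Type*) [Group G] : Prop :=
  IsTwoNCentralizer n G ∧ IsTwoNCentralizer n (G ⧸ Subgroup.center G)

/-- The holomorph `Hol(N) = N ⋊ Aut(N)`, with the natural action of `Aut(N)` on `N`. -/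
abbrev Holomorph (N : Type*) [Group N] : Type _ :=
  N ⋊[MonoidHom.id (MulAut N)] MulAut N

/-- `G` is a non-abelian group of order `n`. -/
def IsNonabelianOfOrder (n : ℕ) (G : Type*) [Group G] : Prop :=
  Nat.card G = n ∧ ∃ a b : G, a * b ≠ b * a

/-! Everything reduces to CA-groups, where centralizers of noncentral elements are abelian. In a
nonabelian CA-group, two distinct proper element centralizers meet in the center $Z$, so
$2\text{-}\mathrm{Cent}(G)$ is $\mathrm{Cent}(G)\cup\{Z\}$, with $G$ itself removed when $Z=1$.
Hence $|2\text{-}\mathrm{Cent}|$ is $|\mathrm{Cent}|+1$ if $Z\neq1$ and $|\mathrm{Cent}|$ if $Z=1$.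
A group that is not CA has at least ten element centralizers (`ten_le_ncard_of_not_isCAGroup`), and
$|\mathrm{Cent}|\le|2\text{-}\mathrm{Cent}|$ for nonabelian groups, so both 9 on the right and 8 on
the left force CA.

If $Z\ne1$ this gives the 8-centralizer case. If $Z=1$, the eight proper centralizers partition
$G\setminus\{1\}$ into abelian Hall subgroups of order at most 7; counting and Sylow
(`IsCAGroup.seven_dvd_card`) yield $7\mid|G|<49$, hence a normal self-centralizing subgroup $A$ of
order 7. Then $G=A\rtimes C(x)$ for $x\notin A$, with $C(x)$ embedded in $\mathrm{Aut}(A)\cong C_6$,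
so $|G|$ is 14, 21 or 42. Conversely, such an $A$ forces exactly nine centralizers.

For primitivity, a group with $Z\ne1$ has $|\mathrm{Cent}(G)|=8$. If $G/Z$ has a self-centralizing
7, centralizers lift bijectively and 8 would be 9; if $G/Z$ is 8-centralizer,
`center_quotient_eq_bot_of_ncard_eq` makes its center trivial, against the assumption. -/

/-! ### Comparing $\mathrm{Cent}$ and $2\text{-}\mathrm{Cent}$; CA-groups -/

section Basics

variable {G : Type*} [Group G]

/-- The centralizer of a single element. -/
abbrev cen (x : G) : Subgroup G := Subgroup.centralizer {x}

theorem mem_cen {a x : G} : a ∈ cen x ↔ Commute a x :=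
  Subgroup.mem_centralizer_singleton_iff

theorem self_mem_cen (x : G) : x ∈ cen x := mem_cen.2 (Commute.refl x)

theorem mem_center_iff_commute {x : G} : x ∈ Subgroup.center G ↔ ∀ y, Commute y x :=
  Subgroup.mem_center_iff

theorem cen_eq_top_iff {x : G} : cen x = ⊤ ↔ x ∈ Subgroup.center G := by
  rw [mem_center_iff_commute, eq_top_iff]
  exact ⟨fun h y => mem_cen.1 (h trivial), fun h y _ => mem_cen.2 (h y)⟩

theorem centralizer_pair (x y : G) : Subgroup.centralizer {x, y} = cen x ⊓ cen y := by
  ext a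
  simp [Subgroup.mem_centralizer_iff, Subgroup.mem_inf]

theorem cen_mem_elementCentralizers (x : G) : cen x ∈ elementCentralizers G := ⟨x, rfl⟩

theorem inf_mem_twoElementCentralizers {x y : G} (h : x ≠ y) :
    cen x ⊓ cen y ∈ twoElementCentralizers G := ⟨x, y, h, (centralizer_pair x y).symm⟩

theorem exists_of_mem_twoElementCentralizers {H : Subgroup G} (h : H ∈ twoElementCentralizers G) :
    ∃ x y : G, x ≠ y ∧ H = cen x ⊓ cen y := by
  obtain ⟨x, y, hxy, rfl⟩ := h
  exact ⟨x, y, hxy, centralizer_pair x y⟩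

/-- Pair $x$ with the identity. -/
theorem cen_mem_twoElementCentralizers {x : G} (h : x ≠ 1) : cen x ∈ twoElementCentralizers G := by
  have := inf_mem_twoElementCentralizers h
  rwa [cen_eq_top_iff.2 (one_mem _), inf_top_eq] at this

theorem top_mem_elementCentralizers : (⊤ : Subgroup G) ∈ elementCentralizers G :=
  cen_eq_top_iff.2 (one_mem (Subgroup.center G)) ▸ cen_mem_elementCentralizers 1

/-- The two elements must be distinct, so a pair centralized by all of $G$ needs a second central
element. This is the only source of the difference between the two counts below. -/
theorem top_mem_twoElementCentralizers_iff :
    (⊤ : Subgroup G) ∈ twoElementCentralizers G ↔ Subgroup.center G ≠ ⊥ := by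
  constructor
  · intro h hZ
    obtain ⟨x, y, hxy, h⟩ := exists_of_mem_twoElementCentralizers h
    have h := inf_eq_top_iff.1 h.symm
    simp only [cen_eq_top_iff, hZ, Subgroup.mem_bot] at h
    exact hxy (h.1.trans h.2.symm)
  · intro h
    obtain ⟨z, hz, hz1⟩ := (Subgroup.bot_or_exists_ne_one (Subgroup.center G)).resolve_left h
    rw [← cen_eq_top_iff.2 hz]
    exact cen_mem_twoElementCentralizers hz1

theorem elementCentralizers_subset (h : Subgroup.center G ≠ ⊥) :
    elementCentralizers G ⊆ twoElementCentralizers G := by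
  rintro _ ⟨x, rfl⟩
  by_cases hx : x = 1
  · subst hx
    change cen 1 ∈ _
    rw [cen_eq_top_iff.2 (one_mem _)]
    exact top_mem_twoElementCentralizers_iff.2 h
  · exact cen_mem_twoElementCentralizers hx

theorem elementCentralizers_diff_subset :
    elementCentralizers G \ {⊤} ⊆ twoElementCentralizers G := by
  rintro _ ⟨⟨x, rfl⟩, hx⟩
  refine cen_mem_twoElementCentralizers fun h => hx ?_
  subst h
  exact cen_eq_top_iff.2 (one_mem _)

/-- Centralizers of noncentral elements are abelian. -/
def IsCAGroup (G : Type*) [Group G] : Prop :=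
  ∀ x a b : G, x ∉ Subgroup.center G → Commute a x → Commute b x → Commute a b

theorem IsCAGroup.cen_eq (h : IsCAGroup G) {x y : G} (hx : x ∉ Subgroup.center G)
    (hy : y ∉ Subgroup.center G) (hxy : Commute x y) : cen x = cen y := by
  ext a
  rw [mem_cen, mem_cen]
  exact ⟨fun ha => h x a y hx ha hxy.symm, fun ha => h y a x hy ha hxy⟩

/-- A noncentral common element $a$ would put $x$ and $y$ in the abelian group $C(a)$. -/
theorem IsCAGroup.cen_inf_cen (h : IsCAGroup G) {x y : G} (hxy : ¬ Commute x y) : cen x ⊓ cen y = Subgroup.center G := by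
  refine le_antisymm (fun a ha => ?_) fun a ha => ?_
  · by_contra hc
    rw [Subgroup.mem_inf, mem_cen, mem_cen] at ha
    exact hxy (h a x y hc ha.1.symm ha.2.symm)
  · rw [mem_center_iff_commute] at ha
    exact ⟨mem_cen.2 (ha x).symm, mem_cen.2 (ha y).symm⟩

theorem exists_notMem_center (h : ¬ ∀ a b : G, Commute a b) : ∃ x, x ∉ Subgroup.center G := by
  push Not at h
  obtain ⟨a, b, h⟩ := h
  exact ⟨a, fun ha => h (mem_center_iff_commute.1 ha b).symm⟩

theorem exists_not_commute {x : G} (h : x ∉ Subgroup.center G) : ∃ y, ¬ Commute x y := by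
  rw [mem_center_iff_commute] at h
  push Not at h
  exact h.imp fun y hy h => hy h.symm

theorem center_notMem_elementCentralizers (h : ¬ ∀ a b : G, Commute a b) :
    Subgroup.center G ∉ elementCentralizers G := by
  rintro ⟨x, hx⟩
  change _ = cen x at hx
  have hxc : x ∈ Subgroup.center G := hx ▸ self_mem_cen x
  rw [cen_eq_top_iff.2 hxc] at hx
  obtain ⟨y, hy⟩ := exists_notMem_center h
  exact hy (hx ▸ trivial)

theorem IsCAGroup.twoElementCentralizers_subset (h : IsCAGroup G) :
    twoElementCentralizers G ⊆ insert (Subgroup.center G) (elementCentralizers G) := by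
  intro H hH
  obtain ⟨x, y, hxy, rfl⟩ := exists_of_mem_twoElementCentralizers hH
  by_cases hx : x ∈ Subgroup.center G
  · rw [cen_eq_top_iff.2 hx, top_inf_eq]
    exact Or.inr (cen_mem_elementCentralizers y)
  by_cases hy : y ∈ Subgroup.center G
  · rw [cen_eq_top_iff.2 hy, inf_top_eq]
    exact Or.inr (cen_mem_elementCentralizers x)
  by_cases hc : Commute x y
  · rw [h.cen_eq hx hy hc, inf_idem]
    exact Or.inr (cen_mem_elementCentralizers y)
  · exact Or.inl (h.cen_inf_cen hc)

theorem IsCAGroup.center_mem (h : IsCAGroup G) (hG : ¬ ∀ a b : G, Commute a b) :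
    Subgroup.center G ∈ twoElementCentralizers G := by
  obtain ⟨x, hx⟩ := exists_notMem_center hG
  obtain ⟨y, hy⟩ := exists_not_commute hx
  rw [← h.cen_inf_cen hy]
  exact inf_mem_twoElementCentralizers fun e => hy (e ▸ Commute.refl _)

theorem IsCAGroup.ncard_two_of_center_ne_bot [Finite G] (h : IsCAGroup G)
    (hG : ¬ ∀ a b : G, Commute a b) (hZ : Subgroup.center G ≠ ⊥) :
    (twoElementCentralizers G).ncard = (elementCentralizers G).ncard + 1 := by
  rw [← Set.ncard_insert_of_notMem (center_notMem_elementCentralizers hG) (Set.toFinite _)]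
  congr 1
  refine subset_antisymm h.twoElementCentralizers_subset
    (Set.insert_subset (h.center_mem hG) (elementCentralizers_subset hZ))

theorem IsCAGroup.ncard_two_of_center_eq_bot [Finite G] (h : IsCAGroup G)
    (hG : ¬ ∀ a b : G, Commute a b) (hZ : Subgroup.center G = ⊥) :
    (twoElementCentralizers G).ncard = (elementCentralizers G).ncard := by
  rw [← Set.ncard_sdiff_singleton_add_one (top_mem_elementCentralizers (G := G)) (Set.toFinite _),
    ← Set.ncard_insert_of_notMem (a := Subgroup.center G) (s := elementCentralizers G \ {⊤})
      (fun hc => center_notMem_elementCentralizers hG hc.1) (Set.toFinite _)]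
  congr 1
  refine subset_antisymm (fun H hH => ?_)
    (Set.insert_subset (h.center_mem hG) elementCentralizers_diff_subset)
  rcases h.twoElementCentralizers_subset hH with h1 | h1
  · exact Or.inl h1
  · exact Or.inr ⟨h1, fun h2 => top_mem_twoElementCentralizers_iff.1 (h2 ▸ hH) hZ⟩

theorem ncard_elementCentralizers_le_one (hG : ∀ a b : G, Commute a b) :
    (elementCentralizers G).ncard ≤ 1 := by
  refine (Set.ncard_le_ncard (t := {⊤}) ?_ (Set.toFinite _)).trans (Set.ncard_singleton _).le
  rintro _ ⟨x, rfl⟩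
  exact cen_eq_top_iff.2 (mem_center_iff_commute.2 fun y => hG y x)

theorem ncard_twoElementCentralizers_le_one (hG : ∀ a b : G, Commute a b) :
    (twoElementCentralizers G).ncard ≤ 1 := by
  refine (Set.ncard_le_ncard (t := {⊤}) ?_ (Set.toFinite _)).trans (Set.ncard_singleton _).le
  intro H hH
  obtain ⟨x, y, -, rfl⟩ := exists_of_mem_twoElementCentralizers hH
  rw [cen_eq_top_iff.2 (mem_center_iff_commute.2 fun z => hG z x),
    cen_eq_top_iff.2 (mem_center_iff_commute.2 fun z => hG z y), top_inf_eq]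
  rfl

/-- A centerless group loses `⊤` from `Cent(G)`, but gains the intersection of a minimal centralizer
with another one. -/
theorem ncard_elementCentralizers_le [Finite G] (hG : ¬ ∀ a b : G, Commute a b) :
    (elementCentralizers G).ncard ≤ (twoElementCentralizers G).ncard := by
  by_cases hZ : Subgroup.center G = ⊥
  · have hne : (elementCentralizers G \ {⊤}).Nonempty := by
      obtain ⟨x, hx⟩ := exists_notMem_center hG
      exact ⟨cen x, cen_mem_elementCentralizers x, fun h => hx (cen_eq_top_iff.1 h)⟩
    obtain ⟨H, ⟨⟨x, hx⟩, hxt⟩, hmin⟩ := (Set.toFinite (elementCentralizers G \ {⊤})).exists_minimal hne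
    change H = cen x at hx
    subst hx
    have hxc : x ∉ Subgroup.center G := fun h => hxt (cen_eq_top_iff.2 h)
    obtain ⟨y, hy⟩ := exists_not_commute hxc
    have hlt : cen x ⊓ cen y ≠ ⊤ := fun h => hxt (inf_eq_top_iff.1 h).1
    -- By minimality the intersection would contain $C(x)$, hence $x$, so $x$ would commute with
    -- $y$.
    have hn : cen x ⊓ cen y ∉ elementCentralizers G \ {⊤} := fun h =>
      hy (mem_cen.1 ((hmin h inf_le_left (self_mem_cen x)).2))
    rw [← Set.ncard_sdiff_singleton_add_one (top_mem_elementCentralizers (G := G)) (Set.toFinite _),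
      ← Set.ncard_insert_of_notMem hn (Set.toFinite _)]
    exact Set.ncard_le_ncard (Set.insert_subset
      (inf_mem_twoElementCentralizers fun e => hy (e ▸ Commute.refl _))
      elementCentralizers_diff_subset) (Set.toFinite _)
  · exact Set.ncard_le_ncard (elementCentralizers_subset hZ) (Set.toFinite _)

end Basics

/-! ### Groups that are not CA have at least ten centralizers -/

section NonCA

variable {G : Type*} [Group G]

theorem two_mul_card_le_of_lt [Finite G] {H K : Subgroup G} (h : H < K) : 2 * Nat.card H ≤ Nat.card K := by
  obtain ⟨c, hc⟩ := Subgroup.card_dvd_of_le h.le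
  have hpos : 0 < Nat.card K := Nat.card_pos
  have hne : Nat.card H ≠ Nat.card K := fun e => h.ne (Subgroup.eq_of_le_of_card_ge h.le e.ge)
  have h0 : c ≠ 0 := by rintro rfl; omega
  have h1 : c ≠ 1 := by rintro rfl; omega
  rw [hc, mul_comm]
  exact Nat.mul_le_mul_left _ (by omega)

/-- The elements of `cen x` that are central in `cen h`. -/
def centralPart (x h : G) : Subgroup G := cen x ⊓ Subgroup.centralizer (cen h : Set G)

theorem commute_of_mem_centralPart {x h m c : G} (hm : m ∈ centralPart x h) (hc : Commute c h) :
    Commute c m := Subgroup.mem_centralizer_iff.1 hm.2 c (mem_cen.2 hc)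

theorem notMem_centralPart {x h : G} (hx : ¬ Commute h x) : x ∉ centralPart x h := fun hm =>
  hx (commute_of_mem_centralPart hm (Commute.refl h))

variable [Finite G]

/-- The central part $M$ is abelian, and $M < C_{C(x)}(M) < C(x)$: $x$ witnesses the first
strictness, $b$ the second. Each step at least doubles the order. -/
theorem four_mul_card_centralPart_le {x h m : G} (hx : ¬ Commute h x)
    (hm : m ∈ centralPart x h) {b : G} (hb : Commute b x) (hbm : ¬ Commute b m) :
    4 * Nat.card (centralPart x h) ≤ Nat.card (cen x) := by
  have h1 : centralPart x h < cen x ⊓ Subgroup.centralizer (centralPart x h : Set G) := by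
    refine lt_of_le_of_ne (fun c hc => ⟨hc.1, Subgroup.mem_centralizer_iff.2 fun d hd => ?_⟩)
      fun e => notMem_centralPart hx ?_
    · exact commute_of_mem_centralPart hc (commute_of_mem_centralPart hd (Commute.refl h)).symm
    · rw [e]
      exact ⟨self_mem_cen x, Subgroup.mem_centralizer_iff.2 fun d hd => mem_cen.1 hd.1⟩
  have h2 : cen x ⊓ Subgroup.centralizer (centralPart x h : Set G) < cen x := by
    refine lt_of_le_of_ne inf_le_left fun e => hbm ?_
    have hb' : b ∈ cen x := mem_cen.2 hb
    rw [← e] at hb'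
    exact (Subgroup.mem_centralizer_iff.1 hb'.2 m hm).symm
  have := two_mul_card_le_of_lt h1
  have := two_mul_card_le_of_lt h2
  omega

/-- Here $M$ is central in $C(x)$, and the chain is $M < Z(C(x)) < C(x)\cap C(a) < C(x)$. -/
theorem eight_mul_card_centralPart_le {x h : G} (hx : ¬ Commute h x)
    (hm : ∀ m ∈ centralPart x h, ∀ b, Commute b x → Commute b m)
    {a b : G} (ha : Commute a x) (hb : Commute b x) (hab : ¬ Commute a b) :
    8 * Nat.card (centralPart x h) ≤ Nat.card (cen x) := by
  set Z : Subgroup G := cen x ⊓ Subgroup.centralizer (cen x : Set G) with hZ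
  have h1 : centralPart x h < Z := by
    refine lt_of_le_of_ne (fun c hc => ⟨hc.1, Subgroup.mem_centralizer_iff.2 fun d hd => ?_⟩)
      fun e => notMem_centralPart hx ?_
    · exact hm c hc d (mem_cen.1 hd)
    · rw [e]
      exact ⟨self_mem_cen x, Subgroup.mem_centralizer_iff.2 fun d hd => mem_cen.1 hd⟩
  have h2 : Z < cen x ⊓ cen a := by
    refine lt_of_le_of_ne (fun c hc => ⟨hc.1, ?_⟩) fun e => hab ?_
    · exact mem_cen.2 (Subgroup.mem_centralizer_iff.1 hc.2 a (mem_cen.2 ha)).symm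
    · have : a ∈ Z := e ▸ (⟨mem_cen.2 ha, self_mem_cen a⟩ : a ∈ cen x ⊓ cen a)
      exact (Subgroup.mem_centralizer_iff.1 this.2 b (mem_cen.2 hb)).symm
  have h3 : cen x ⊓ cen a < cen x := by
    refine lt_of_le_of_ne inf_le_left fun e => hab ?_
    have hb' : b ∈ cen x := mem_cen.2 hb
    rw [← e] at hb'
    exact (mem_cen.1 hb'.2).symm
  have := two_mul_card_le_of_lt h1
  have := two_mul_card_le_of_lt h2
  have := two_mul_card_le_of_lt h3
  omega

/-- No element of the coset $C(x)g$ commutes with $x$. If $kg$ and $k'g$ have the same centralizer,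
then $k'k^{-1}$ lies in the central part for $kg$; so each fiber of $k\mapsto C(kg)$ has at most
$|C(x)|/c$ elements. -/
theorem le_ncard_notMem {x g : G} (hg : ¬ Commute g x) {c : ℕ}
    (hc : ∀ h, ¬ Commute h x → c * Nat.card (centralPart x h) ≤ Nat.card (cen x)) :
    c ≤ {H ∈ elementCentralizers G | x ∉ H}.ncard := by
  classical
  rcases Nat.eq_zero_or_pos c with rfl | hcpos
  · exact Nat.zero_le _
  have hkg : ∀ k ∈ cen x, ¬ Commute (k * g) x := fun k hk h => hg <| by
    have := ((mem_cen.1 hk).inv_left).mul_left h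
    rwa [inv_mul_cancel_left] at this
  have := Fintype.ofFinite (cen x)
  set n := Nat.card (cen x) / c with hn
  set f : cen x → Subgroup G := fun k => cen ((k : G) * g) with hf
  have hfib : ∀ H ∈ Finset.univ.image f, (Finset.univ.filter fun k => f k = H).card ≤ n := by
    intro H hH
    obtain ⟨k, -, rfl⟩ := Finset.mem_image.1 hH
    rw [hn, Nat.le_div_iff_mul_le hcpos, mul_comm]
    refine le_trans (Nat.mul_le_mul_left c ?_) (hc _ (hkg k k.2))
    rw [← Nat.card_eq_finsetCard]
    have key : ∀ k' ∈ Finset.univ.filter fun k' => f k' = f k,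
        (k' : G) * (k : G)⁻¹ ∈ centralPart x (k * g) := by
      intro k' hk'
      have he : cen ((k' : G) * g) = cen ((k : G) * g) := (Finset.mem_filter.1 hk').2
      refine ⟨(cen x).mul_mem k'.2 ((cen x).inv_mem k.2), Subgroup.mem_centralizer_iff.2 fun d hd => ?_⟩
      have h1 : Commute d (k' * g) := mem_cen.1 (he ▸ hd)
      have h2 : Commute d (k * g) := mem_cen.1 hd
      have h3 := h1.mul_right h2.inv_right
      rwa [mul_inv_rev, mul_assoc, mul_inv_cancel_left] at h3
    refine Nat.card_le_card_of_injective
      (fun k' => (⟨_, key k'.1 k'.2⟩ : centralPart x (k * g))) fun k₁ k₂ h => ?_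
    exact Subtype.ext (Subtype.ext (mul_right_cancel (Subtype.ext_iff.1 h)))
  have h1 := Finset.card_le_mul_card_image Finset.univ n hfib
  have h2 : (Finset.univ.image f).card ≤ {H ∈ elementCentralizers G | x ∉ H}.ncard := by
    rw [← Set.ncard_coe_finset]
    refine Set.ncard_le_ncard ?_ (Set.toFinite _)
    intro H hH
    obtain ⟨k, -, rfl⟩ := Finset.mem_image.1 (Finset.mem_coe.1 hH)
    exact ⟨cen_mem_elementCentralizers _, fun h => hkg k k.2 (mem_cen.1 h).symm⟩
  rw [Finset.card_univ, ← Nat.card_eq_fintype_card] at h1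
  have hnpos : 0 < n := by
    have : 0 < Nat.card (centralPart x g) := Nat.card_pos
    exact Nat.div_pos (le_trans (Nat.le_mul_of_pos_right c this) (hc g hg)) hcpos
  have h3 : c * n ≤ Nat.card (cen x) := Nat.mul_div_le _ _
  have h4 : n * c ≤ n * {H ∈ elementCentralizers G | x ∉ H}.ncard := by
    calc n * c = c * n := mul_comm _ _
      _ ≤ _ := h3.trans (h1.trans (Nat.mul_le_mul_left _ h2))
  exact Nat.le_of_mul_le_mul_left h4 hnpos

theorem two_le_ncard_mem {x : G} (hx : x ∉ Subgroup.center G) :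
    2 ≤ {H ∈ elementCentralizers G | x ∈ H}.ncard := by
  have hne : cen x ≠ ⊤ := fun h => hx (cen_eq_top_iff.1 h)
  rw [← Set.ncard_pair hne]
  refine Set.ncard_le_ncard ?_ (Set.toFinite _)
  rintro _ (rfl | rfl)
  · exact ⟨cen_mem_elementCentralizers x, self_mem_cen x⟩
  · exact ⟨top_mem_elementCentralizers, trivial⟩

/-- The six are $G$, $C(x)$, $C(m)$, $C(mx)$, $C(b)$, $C(mb)$, told apart by membership of $g$, $m$,
$b$ and $mb$. -/
theorem six_le_ncard_mem {x g m b : G} (hg : ¬ Commute g x) (hm : Commute m x) (hgm : Commute g m)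
    (hb : Commute b x) (hbm : ¬ Commute b m) :
    6 ≤ {H ∈ elementCentralizers G | x ∈ H}.ncard := by
  classical
  have hbmm : ¬ Commute b (m * x) := fun h => hbm <| by
    simpa using h.mul_right hb.inv_right
  have hmb : ¬ Commute (m * b) m := fun h => hbm <| by
    simpa using ((Commute.refl m).inv_left).mul_left h
  have hmbb : ¬ Commute (m * b) b := fun h => hbm <| by
    simpa using (h.mul_left (Commute.refl b).inv_left).symm
  have hmbmx : ¬ Commute (m * b) (m * x) := fun h => hmb <| by
    simpa using h.mul_right ((hm.mul_left hb).inv_right)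
  have hgmx : ¬ Commute g (m * x) := fun h => hg <| by
    simpa using hgm.inv_right.mul_right h
  have hmbx : Commute (m * b) x := hm.mul_left hb
  have hcard : ({⊤, cen x, cen m, cen (m * x), cen b, cen (m * b)} : Finset (Subgroup G)).card = 6 := by
    have sep : ∀ {H K : Subgroup G} (c : G), c ∈ H → c ∉ K → H ≠ K :=
      fun c h1 h2 e => h2 (e ▸ h1)
    repeat' rw [Finset.card_insert_of_notMem]
    · simp
    all_goals simp only [Finset.mem_insert, Finset.mem_singleton, not_or]
    · exact sep b (self_mem_cen b) fun h => hmbb (mem_cen.1 h).symm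
    · exact ⟨(sep b (self_mem_cen b) fun h => hbmm (mem_cen.1 h)).symm,
        (sep (m * b) (self_mem_cen _) fun h => hmbmx (mem_cen.1 h)).symm⟩
    · exact ⟨sep g (mem_cen.2 hgm) fun h => hgmx (mem_cen.1 h),
        (sep b (self_mem_cen b) fun h => hbm (mem_cen.1 h)).symm,
        (sep (m * b) (self_mem_cen _) fun h => hmb (mem_cen.1 h)).symm⟩
    · exact ⟨sep b (mem_cen.2 hb) fun h => hbm (mem_cen.1 h),
        sep b (mem_cen.2 hb) fun h => hbmm (mem_cen.1 h),
        sep m (mem_cen.2 hm) fun h => hbm (mem_cen.1 h).symm,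
        sep b (mem_cen.2 hb) fun h => hmbb (mem_cen.1 h).symm⟩
    · exact ⟨sep g trivial fun h => hg (mem_cen.1 h), sep b trivial fun h => hbm (mem_cen.1 h),
        sep g trivial fun h => hgmx (mem_cen.1 h), sep m trivial fun h => hbm (mem_cen.1 h).symm,
        sep b trivial fun h => hmbb (mem_cen.1 h).symm⟩
  rw [← hcard, ← Set.ncard_coe_finset]
  refine Set.ncard_le_ncard ?_ (Set.toFinite _)
  intro H hH
  simp only [Finset.coe_insert, Finset.coe_singleton, Set.mem_insert_iff,
    Set.mem_singleton_iff] at hH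
  rcases hH with rfl | rfl | rfl | rfl | rfl | rfl
  · exact ⟨top_mem_elementCentralizers, trivial⟩
  · exact ⟨cen_mem_elementCentralizers _, self_mem_cen x⟩
  · exact ⟨cen_mem_elementCentralizers _, mem_cen.2 hm.symm⟩
  · exact ⟨cen_mem_elementCentralizers _, mem_cen.2 (hm.symm.mul_right (Commute.refl x))⟩
  · exact ⟨cen_mem_elementCentralizers _, mem_cen.2 hb.symm⟩
  · exact ⟨cen_mem_elementCentralizers _, mem_cen.2 hmbx.symm⟩

theorem ten_le_ncard_of_not_isCAGroup (h : ¬ IsCAGroup G) : 10 ≤ (elementCentralizers G).ncard := by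
  unfold IsCAGroup at h
  push Not at h
  obtain ⟨x, a, b, hx, ha, hb, hab⟩ := h
  have hsplit : {H ∈ elementCentralizers G | x ∈ H}.ncard +
      {H ∈ elementCentralizers G | x ∉ H}.ncard = (elementCentralizers G).ncard := by
    rw [← Set.ncard_union_eq _ (Set.toFinite _) (Set.toFinite _)]
    · congr 1
      ext H
      simp only [Set.mem_union, Set.mem_ofPred_eq]
      tauto
    · rw [Set.disjoint_left]
      exact fun H h1 h2 => h2.2 h1.2
  rw [← hsplit]
  obtain ⟨g₀, hg₀⟩ := exists_not_commute hx
  replace hg₀ : ¬ Commute g₀ x := fun h => hg₀ h.symm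
  -- Centralizers containing $x$ plus those missing it: $6+4$ if some central part is not central in
  -- $C(x)$, and $2+8$ otherwise.
  by_cases hc : ∃ g m b, ¬ Commute g x ∧ m ∈ centralPart x g ∧ Commute b x ∧ ¬ Commute b m
  · obtain ⟨g, m, b', hg, hm, hb', hbm⟩ := hc
    have h1 := six_le_ncard_mem hg (mem_cen.1 hm.1)
      (commute_of_mem_centralPart hm (Commute.refl g)) hb' hbm
    have h2 : 4 ≤ {H ∈ elementCentralizers G | x ∉ H}.ncard := by
      refine le_ncard_notMem hg₀ fun h hh => ?_
      by_cases hc' : ∃ m b, m ∈ centralPart x h ∧ Commute b x ∧ ¬ Commute b m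
      · obtain ⟨m, b', hm, hb', hbm⟩ := hc'
        exact four_mul_card_centralPart_le hh hm hb' hbm
      · push Not at hc'
        have := eight_mul_card_centralPart_le hh (fun m hm b hb => hc' m b hm hb) ha hb hab
        omega
    omega
  · push Not at hc
    have h1 := two_le_ncard_mem hx
    have h2 := le_ncard_notMem hg₀ fun h hh =>
      eight_mul_card_centralPart_le hh (fun m hm b hb => hc h m b hh hm hb) ha hb hab
    omega

end NonCA

/-! ### Centerless CA-groups: the partition by proper centralizers -/

section Partition

variable {G : Type*} [Group G]

theorem notMem_center_of_ne_one (hZ : Subgroup.center G = ⊥) {x : G} (hx : x ≠ 1) :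
    x ∉ Subgroup.center G := by rwa [hZ, Subgroup.mem_bot]

theorem ne_one_of_notMem_center {x : G} (hx : x ∉ Subgroup.center G) : x ≠ 1 :=
  fun h => hx (h ▸ one_mem _)

variable [Finite G]

/-- The proper centralizers of elements of `G`. -/
noncomputable def properCentralizers (G : Type*) [Group G] [Finite G] : Finset (Subgroup G) :=
  (Set.toFinite (elementCentralizers G \ {⊤})).toFinset

theorem mem_properCentralizers {A : Subgroup G} :
    A ∈ properCentralizers G ↔ ∃ x, x ∉ Subgroup.center G ∧ A = cen x := by
  rw [properCentralizers, Set.Finite.mem_toFinset]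
  constructor
  · rintro ⟨⟨x, rfl⟩, hx⟩
    exact ⟨x, fun h => hx (cen_eq_top_iff.2 h), rfl⟩
  · rintro ⟨x, hx, rfl⟩
    exact ⟨cen_mem_elementCentralizers x, fun h => hx (cen_eq_top_iff.1 h)⟩

theorem card_properCentralizers_add_one :
    (properCentralizers G).card + 1 = (elementCentralizers G).ncard := by
  rw [← Set.ncard_sdiff_singleton_add_one (top_mem_elementCentralizers (G := G)) (Set.toFinite _),
    properCentralizers, Set.ncard_eq_toFinset_card _ (Set.toFinite _)]

theorem cen_mem_properCentralizers (hZ : Subgroup.center G = ⊥) {x : G} (hx : x ≠ 1) :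
    cen x ∈ properCentralizers G :=
  mem_properCentralizers.2 ⟨x, notMem_center_of_ne_one hZ hx, rfl⟩

theorem IsCAGroup.commute_of_mem (h : IsCAGroup G) {A : Subgroup G} (hA : A ∈ properCentralizers G)
    {a b : G} (ha : a ∈ A) (hb : b ∈ A) : Commute a b := by
  obtain ⟨x, hx, rfl⟩ := mem_properCentralizers.1 hA
  exact h x a b hx (mem_cen.1 ha) (mem_cen.1 hb)

theorem IsCAGroup.eq_cen_of_mem (h : IsCAGroup G) (hZ : Subgroup.center G = ⊥) {A : Subgroup G}
    (hA : A ∈ properCentralizers G) {a : G} (ha : a ∈ A) (ha1 : a ≠ 1) : A = cen a := by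
  obtain ⟨x, hx, rfl⟩ := mem_properCentralizers.1 hA
  exact h.cen_eq hx (notMem_center_of_ne_one hZ ha1) (mem_cen.1 ha).symm

theorem IsCAGroup.eq_of_mem_of_mem (h : IsCAGroup G) (hZ : Subgroup.center G = ⊥)
    {A B : Subgroup G} (hA : A ∈ properCentralizers G) (hB : B ∈ properCentralizers G) {a : G}
    (ha : a ∈ A) (hb : a ∈ B) (ha1 : a ≠ 1) : A = B :=
  (h.eq_cen_of_mem hZ hA ha ha1).trans (h.eq_cen_of_mem hZ hB hb ha1).symm

theorem two_le_card_of_mem {A : Subgroup G} (hA : A ∈ properCentralizers G) : 2 ≤ Nat.card A := by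
  obtain ⟨x, hx, rfl⟩ := mem_properCentralizers.1 hA
  rw [Nat.succ_le_iff, Subgroup.one_lt_card_iff_ne_bot]
  intro hb
  exact ne_one_of_notMem_center hx (Subgroup.mem_bot.1 (hb ▸ self_mem_cen x))

theorem IsCAGroup.sum_card_properCentralizers (h : IsCAGroup G) (hZ : Subgroup.center G = ⊥) :
    ∑ A ∈ properCentralizers G, (Nat.card A - 1) = Nat.card G - 1 := by
  classical
  have := Fintype.ofFinite G
  have h1 : ((Finset.univ : Finset G).erase 1).card = Nat.card G - 1 := by
    rw [Finset.card_erase_of_mem (Finset.mem_univ _), Finset.card_univ, Nat.card_eq_fintype_card]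
  rw [← h1, Finset.card_eq_sum_card_fiberwise (f := cen) (t := properCentralizers G)]
  · refine Finset.sum_congr rfl fun A hA => ?_
    have h2 : Nat.card A = (Finset.univ.filter fun g : G => g ∈ A).card := by
      rw [← Nat.card_eq_finsetCard]
      exact Nat.card_congr (Equiv.subtypeEquivRight fun g => by simp)
    rw [h2, ← Finset.card_erase_of_mem (a := (1 : G)) (by simp [one_mem])]
    congr 1
    ext g
    simp only [Finset.mem_erase, Finset.mem_filter, Finset.mem_univ, true_and, and_true]
    refine and_congr_right fun hg => ⟨fun hgA => (h.eq_cen_of_mem hZ hA hgA hg).symm, ?_⟩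
    rintro rfl
    exact self_mem_cen g
  · intro g hg
    exact cen_mem_properCentralizers hZ (Finset.ne_of_mem_erase hg)

/-- For $x\notin A$, the elements of $xA$ lie in distinct members other than $A$: if $xa$ and $xb$
shared one, $a^{-1}b\in A$ would lie in it too. -/
theorem IsCAGroup.card_lt_card_properCentralizers (h : IsCAGroup G) (hZ : Subgroup.center G = ⊥)
    {A : Subgroup G} (hA : A ∈ properCentralizers G) :
    Nat.card A < (properCentralizers G).card := by
  classical
  have hx : ∃ x, x ∉ A := by
    obtain ⟨x, hx, rfl⟩ := mem_properCentralizers.1 hA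
    obtain ⟨y, hy⟩ := exists_not_commute hx
    exact ⟨y, fun h => hy (mem_cen.1 h).symm⟩
  obtain ⟨x, hx⟩ := hx
  have hxa : ∀ a : A, x * a ∉ A := fun a ha => hx ((A.mul_mem_cancel_right a.2).1 ha)
  have hne : ∀ a : A, x * a ≠ 1 := fun a ha => hxa a (ha ▸ one_mem A)
  have hmem : ∀ a : A, cen (x * a) ∈ (properCentralizers G).erase A := fun a =>
    Finset.mem_erase.2 ⟨fun e => hxa a ((SetLike.ext_iff.1 e _).1 (self_mem_cen _)), cen_mem_properCentralizers hZ (hne a)⟩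
  have hinj : Function.Injective
      (fun a : A => (⟨_, hmem a⟩ : (properCentralizers G).erase A)) := by
    intro a b hab
    have hab' : cen (x * a) = cen (x * b) := Subtype.ext_iff.1 hab
    by_contra hne'
    have h1 : (a : G)⁻¹ * b ∈ cen (x * a) := by
      have := mul_mem (inv_mem (self_mem_cen (x * (a : G)))) (hab'.symm ▸ self_mem_cen (x * (b : G)) : x * (b : G) ∈ cen (x * (a : G)))
      rwa [mul_inv_rev, mul_assoc, inv_mul_cancel_left] at this
    have h2 : (a : G)⁻¹ * b ∈ A := mul_mem (inv_mem a.2) b.2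
    have h3 : (a : G)⁻¹ * b ≠ 1 := fun e => hne' (Subtype.ext (inv_mul_eq_one.1 e))
    have := h.eq_of_mem_of_mem hZ hA (Finset.mem_of_mem_erase (hmem a)) h2 h1 h3
    exact hxa a ((SetLike.ext_iff.1 this _).2 (self_mem_cen _))
  have := Nat.card_le_card_of_injective _ hinj
  rw [Nat.card_eq_finsetCard, Finset.card_erase_of_mem hA] at this
  have : 0 < (properCentralizers G).card := Finset.card_pos.2 ⟨A, hA⟩
  omega

theorem exists_le_of_sylow (hZ : Subgroup.center G = ⊥) {p : ℕ} [Fact p.Prime]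
    (hp : p ∣ Nat.card G) (P : Sylow p G) : ∃ A ∈ properCentralizers G, (P : Subgroup G) ≤ A := by
  have hP := P.ne_bot_of_dvd_card hp
  have : Nontrivial (P : Subgroup G) := (Subgroup.nontrivial_iff_ne_bot _).2 hP
  have : Nontrivial (Subgroup.center P) := P.isPGroup'.center_nontrivial
  obtain ⟨z, hz⟩ := exists_ne (1 : Subgroup.center P)
  refine ⟨cen ((z : P) : G), cen_mem_properCentralizers hZ fun e => hz ?_, fun g hg => ?_⟩
  · exact Subtype.ext (Subtype.ext e)
  · exact mem_cen.2 (congrArg Subtype.val (Subgroup.mem_center_iff.1 z.2 ⟨g, hg⟩))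

theorem exists_pow_dvd_card (hZ : Subgroup.center G = ⊥) {p k : ℕ} (hp : p.Prime)
    (hk : p ^ (k + 1) ∣ Nat.card G) : ∃ A ∈ properCentralizers G, p ^ (k + 1) ∣ Nat.card A := by
  have := Fact.mk hp
  obtain ⟨P⟩ : Nonempty (Sylow p G) := inferInstance
  obtain ⟨A, hA, hPA⟩ := exists_le_of_sylow hZ ((dvd_pow_self p k.succ_ne_zero).trans hk) P
  exact ⟨A, hA, (P.pow_dvd_card_of_pow_dvd_card hk).trans (Subgroup.card_dvd_of_le hPA)⟩

/-- A Sylow subgroup through an element of order $p$ of $A$ lies in a single member of the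
partition, which must be $A$. Thus the members are Hall subgroups. -/
theorem IsCAGroup.exists_sylow_le (h : IsCAGroup G) (hZ : Subgroup.center G = ⊥) {p : ℕ}
    [Fact p.Prime] {A : Subgroup G} (hA : A ∈ properCentralizers G) (hpA : p ∣ Nat.card A) :
    ∃ P : Sylow p G, (P : Subgroup G) ≤ A := by
  obtain ⟨a, ha⟩ := exists_prime_orderOf_dvd_card' p hpA
  rw [← Subgroup.orderOf_coe] at ha
  have ha1 : (a : G) ≠ 1 := fun e => (Fact.out : p.Prime).one_lt.ne (by rw [← ha, e, orderOf_one])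
  have hpg : IsPGroup p (Subgroup.zpowers (a : G)) :=
    IsPGroup.of_card (n := 1) (by rw [Nat.card_zpowers, ha, pow_one])
  obtain ⟨P, hP⟩ := hpg.exists_le_sylow
  obtain ⟨B, hB, hPB⟩ := exists_le_of_sylow hZ (hpA.trans A.card_subgroup_dvd_card) P
  refine ⟨P, ?_⟩
  rwa [h.eq_of_mem_of_mem hZ hA hB a.2 (hPB (hP (Subgroup.mem_zpowers _))) ha1]

theorem IsCAGroup.pow_dvd_card (h : IsCAGroup G) (hZ : Subgroup.center G = ⊥) {p k : ℕ}
    (hp : p.Prime) {A : Subgroup G} (hA : A ∈ properCentralizers G) (hpA : p ∣ Nat.card A)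
    (hk : p ^ k ∣ Nat.card G) : p ^ k ∣ Nat.card A := by
  have := Fact.mk hp
  obtain ⟨P, hP⟩ := h.exists_sylow_le hZ hA hpA
  exact (P.pow_dvd_card_of_pow_dvd_card hk).trans (Subgroup.card_dvd_of_le hP)

/-- Sending a Sylow $p$-subgroup to the member containing it is a bijection onto the members of
order divisible by $p$; it is injective because members are abelian, so two Sylow subgroups in one
member normalize each other. -/
theorem IsCAGroup.card_filter_dvd_modEq_one (h : IsCAGroup G) (hZ : Subgroup.center G = ⊥) {p : ℕ}
    (hp : p.Prime) (hpG : p ∣ Nat.card G) :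
    ((properCentralizers G).filter fun A : Subgroup G => p ∣ Nat.card A).card ≡ 1 [MOD p] := by
  have := Fact.mk hp
  suffices hs : ((properCentralizers G).filter fun A : Subgroup G => p ∣ Nat.card A).card
      = Nat.card (Sylow p G) by
    rw [hs]
    exact card_sylow_modEq_one p G
  have hdvd : ∀ P : Sylow p G, p ∣ Nat.card P := fun P => P.dvd_card_of_dvd_card hpG
  choose f hf hPf using exists_le_of_sylow hZ hpG
  rw [← Nat.card_eq_finsetCard]
  refine (Nat.card_congr (Equiv.ofBijective (fun P : Sylow p G => (⟨f P, Finset.mem_filter.2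
    ⟨hf P, (hdvd P).trans (Subgroup.card_dvd_of_le (hPf P))⟩⟩ :
      (properCentralizers G).filter fun A : Subgroup G => p ∣ Nat.card A)) ⟨fun P Q hPQ => ?_, ?_⟩)).symm
  · have hPQ' : f P = f Q := Subtype.ext_iff.1 hPQ
    have hle : ∀ P Q : Sylow p G, f P = f Q → (P : Subgroup G) ≤ Q := by
      intro P Q hPQ
      have h1 := P.isPGroup'.inf_normalizer_sylow Q
      have h2 : (P : Subgroup G) ≤ Subgroup.normalizer (Q : Set G) := by
        refine fun a ha => Subgroup.centralizer_le_normalizer _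
          (Subgroup.mem_centralizer_iff.2 fun b hb => ?_)
        exact h.commute_of_mem (hf P) (hPQ ▸ hPf Q hb) (hPf P ha)
      rw [inf_eq_left.2 h2] at h1
      exact inf_eq_left.1 h1.symm
    exact Sylow.ext (le_antisymm (hle P Q hPQ') (hle Q P hPQ'.symm))
  · rintro ⟨A, hA⟩
    obtain ⟨hA, hpA⟩ := Finset.mem_filter.1 hA
    obtain ⟨P, hP⟩ := h.exists_sylow_le hZ hA hpA
    refine ⟨P, Subtype.ext ?_⟩
    obtain ⟨a, ha, ha1⟩ := (Subgroup.bot_or_exists_ne_one (P : Subgroup G)).resolve_left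
      (P.ne_bot_of_dvd_card hpG)
    exact h.eq_of_mem_of_mem hZ (hf P) hA (hPf P ha) (hP ha) ha1

theorem IsCAGroup.seven_dvd_card (h : IsCAGroup G) (hZ : Subgroup.center G = ⊥)
    (h8 : (properCentralizers G).card = 8) :
    7 ∣ Nat.card G ∧ Nat.card G < 49 ∧ ∀ A ∈ properCentralizers G, Nat.card A ≤ 7 := by
  have hle : ∀ A ∈ properCentralizers G, Nat.card A ≤ 7 := fun A hA => by
    have := h.card_lt_card_properCentralizers hZ hA
    omega
  have hsum : ∑ A ∈ properCentralizers G, Nat.card A = Nat.card G + 7 := by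
    have h1 := h.sum_card_properCentralizers hZ
    have h2 : ∑ A ∈ properCentralizers G, Nat.card A =
        ∑ A ∈ properCentralizers G, (Nat.card A - 1) + 8 := by
      rw [← h8, Finset.card_eq_sum_ones, ← Finset.sum_add_distrib]
      refine Finset.sum_congr rfl fun A hA => ?_
      have := two_le_card_of_mem hA
      omega
    have : 0 < Nat.card G := Nat.card_pos
    omega
  have hlow : ∀ c, (∀ A ∈ properCentralizers G, c ≤ Nat.card A) → 8 * c ≤ Nat.card G + 7 := by
    intro c hc
    have := Finset.card_nsmul_le_sum _ (fun A : Subgroup G => Nat.card A) c hc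
    rwa [h8, hsum, smul_eq_mul] at this
  have hN9 := hlow 2 fun A hA => two_le_card_of_mem hA
  have hN49 : Nat.card G + 7 ≤ 56 := by
    have := Finset.sum_le_card_nsmul _ (fun A : Subgroup G => Nat.card A) 7 hle
    rwa [h8, hsum, smul_eq_mul] at this
  have hpow : ∀ p k : ℕ, p.Prime → p ^ (k + 1) ∣ Nat.card G → p ^ (k + 1) ≤ 7 := by
    intro p k hp hk
    obtain ⟨A, hA, hd⟩ := exists_pow_dvd_card hZ hp hk
    exact (Nat.le_of_dvd Nat.card_pos hd).trans (hle A hA)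
  have hdvd : ∀ A ∈ properCentralizers G, Nat.card A ∣ Nat.card G :=
    fun A _ => A.card_subgroup_dvd_card
  have h3mod := h.card_filter_dvd_modEq_one hZ Nat.prime_three
  have hhall : ∀ A ∈ properCentralizers G, ∀ p k : ℕ, p.Prime → p ∣ Nat.card A →
      p ^ k ∣ Nat.card G → p ^ k ∣ Nat.card A := fun A hA p k hp => h.pow_dvd_card hZ hp hA
  have h49 : Nat.card G ≠ 49 := fun e => by
    have := hpow 7 1 (by norm_num) (by rw [e]; norm_num)
    omega
  refine ⟨?_, by omega, hle⟩
  by_contra h7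
  have hprime : ∀ p, p.Prime → 7 < p → ¬ p ∣ Nat.card G := fun p hp hlt hd => by
    have := hpow p 0 hp (by simpa using hd)
    rw [zero_add, pow_one] at this
    omega
  have h8' : ¬ 8 ∣ Nat.card G := fun hd => by
    have := hpow 2 2 Nat.prime_two hd
    omega
  have h9 : ¬ 9 ∣ Nat.card G := fun hd => by
    have := hpow 3 1 Nat.prime_three hd
    omega
  have h25 : ¬ 25 ∣ Nat.card G := fun hd => by
    have := hpow 5 1 Nat.prime_five hd
    omega
  have h11 := hprime 11 (by norm_num) (by norm_num)
  have h13 := hprime 13 (by norm_num) (by norm_num)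
  have h17 := hprime 17 (by norm_num) (by norm_num)
  have h19 := hprime 19 (by norm_num) (by norm_num)
  have h23 := hprime 23 (by norm_num) (by norm_num)
  have h29 := hprime 29 (by norm_num) (by norm_num)
  have h31 := hprime 31 (by norm_num) (by norm_num)
  have h37 := hprime 37 (by norm_num) (by norm_num)
  have h41 := hprime 41 (by norm_num) (by norm_num)
  have h43 := hprime 43 (by norm_num) (by norm_num)
  have h47 := hprime 47 (by norm_num) (by norm_num)
  -- If $7\nmid|G|$, then $|G|$ divides $60$, and $9\le|G|\le 49$.
  have hcases : Nat.card G = 10 ∨ Nat.card G = 12 ∨ Nat.card G = 15 ∨ Nat.card G = 20 ∨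
      Nat.card G = 30 := by
    clear hsum hlow hpow hdvd hhall hprime h3mod
    generalize Nat.card G = N at *
    have : N ≤ 49 := by omega
    have : 9 ≤ N := by omega
    interval_cases N <;> omega
  have hA2 : ∀ A ∈ properCentralizers G, 2 ≤ Nat.card A := fun A hA => two_le_card_of_mem hA
  rcases hcases with e | e | e | e | e <;> rw [e] at hsum hlow hdvd hhall h3mod
  -- Orders 2 and 5 are both $2$ mod $3$, but $17+8$ is not divisible by $3$.
  · have : 3 ∣ ∑ A ∈ properCentralizers G, (Nat.card A + 1) := by
      refine Finset.dvd_sum fun A hA => ?_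
      have h1 := hle A hA
      have h2 := hdvd A hA
      have h3 := hA2 A hA
      generalize Nat.card A = c at h1 h2 h3 ⊢
      interval_cases c <;> omega
    rw [Finset.sum_add_distrib, hsum, ← Finset.card_eq_sum_ones, h8] at this
    omega
  · have := hlow 3 fun A hA => by
      have h1 := hhall A hA 2 2 Nat.prime_two
      have h3 := hA2 A hA
      omega
    omega
  · have := hlow 3 fun A hA => by
      have h2 := hdvd A hA
      have h3 := hA2 A hA
      by_contra hc
      have : Nat.card A = 2 := by omega
      rw [this] at h2
      omega
    omega
  · have := hlow 4 fun A hA => by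
      have h1 := hhall A hA 2 2 Nat.prime_two
      have h2 := hdvd A hA
      have h3 := hA2 A hA
      by_contra hc
      have : Nat.card A = 2 ∨ Nat.card A = 3 := by omega
      rcases this with e | e <;> rw [e] at h1 h2 <;> omega
    omega
  -- Orders prime to $3$ are again $2$ mod $3$. A total of $37$ makes the number of members of order
  -- divisible by $3$ a multiple of $3$, while Sylow requires $1$ mod $3$.
  · have h3 : 3 ∣ ∑ A ∈ properCentralizers G, (Nat.card A + if 3 ∣ Nat.card A then 0 else 1) := by
      refine Finset.dvd_sum fun A hA => ?_
      have h1 := hle A hA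
      have h2 := hdvd A hA
      have h3 := hA2 A hA
      generalize Nat.card A = c at h1 h2 h3 ⊢
      interval_cases c <;> first | omega | norm_num
    have h4 := Finset.card_filter_add_card_filter_not (s := properCentralizers G)
      (fun A : Subgroup G => 3 ∣ Nat.card A)
    have h5 : ∑ A ∈ properCentralizers G, (if 3 ∣ Nat.card A then 0 else 1) =
        ((properCentralizers G).filter fun A : Subgroup G => ¬ 3 ∣ Nat.card A).card := by
      rw [Finset.card_filter]
      exact Finset.sum_congr rfl fun A _ => by split_ifs <;> rfl
    rw [Finset.sum_add_distrib, hsum, h5] at h3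
    have h6 := h3mod (by norm_num)
    rw [Nat.ModEq] at h6
    omega

theorem exists_normal_sylow_seven {m : ℕ} (hm : m < 7) (hG : Nat.card G = 7 * m) :
    ∃ P : Sylow 7 G, (P : Subgroup G).Normal ∧ Nat.card P = 7 := by
  have : Fact (Nat.Prime 7) := ⟨by norm_num⟩
  have h0 : 0 < Nat.card G := Nat.card_pos
  have hlt : Nat.card G < 49 := by omega
  obtain ⟨P⟩ : Nonempty (Sylow 7 G) := inferInstance
  have hPc : Nat.card P = 7 := by
    obtain ⟨k, hk⟩ := P.isPGroup'.exists_card_eq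
    have h7 : 7 ∣ Nat.card P := P.dvd_card_of_dvd_card ⟨m, hG⟩
    have hle : Nat.card P ≤ Nat.card G := Subgroup.card_le_card_group _
    have hk0 : k ≠ 0 := by
      rintro rfl
      rw [hk] at h7
      norm_num at h7
    have hk2 : k < 2 := by
      by_contra hc
      have := Nat.pow_le_pow_right (n := 7) (by norm_num) (not_lt.1 hc)
      omega
    obtain rfl : k = 1 := by omega
    simpa using hk
  have hidx : (P : Subgroup G).index < 7 := by
    have := (P : Subgroup G).card_mul_index
    rw [hPc] at this
    omega
  have hn : Nat.card (Sylow 7 G) = 1 := by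
    have h1 := card_sylow_modEq_one 7 G
    have h2 := Nat.le_of_dvd (Nat.pos_of_ne_zero Subgroup.index_ne_zero_of_finite) P.card_dvd_index
    rw [Nat.ModEq] at h1
    omega
  have : Subsingleton (Sylow 7 G) := (Nat.card_eq_one_iff_unique.1 hn).1
  exact ⟨P, P.normal_of_subsingleton, hPc⟩

/-- `G` has a proper self-centralizing normal subgroup of order `7`. -/
def HasSelfCentralizingSeven (G : Type*) [Group G] : Prop :=
  ∃ A : Subgroup G, A.Normal ∧ Nat.card A = 7 ∧ Subgroup.centralizer (A : Set G) = A ∧ A ≠ ⊤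

theorem IsCAGroup.hasSelfCentralizingSeven (h : IsCAGroup G) (hZ : Subgroup.center G = ⊥)
    (h9 : (elementCentralizers G).ncard = 9) : HasSelfCentralizingSeven G := by
  have h8 : (properCentralizers G).card = 8 := by
    have := card_properCentralizers_add_one (G := G)
    omega
  obtain ⟨h7, hlt, hle⟩ := h.seven_dvd_card hZ h8
  have : Fact (Nat.Prime 7) := ⟨by norm_num⟩
  obtain ⟨P, hnorm, hPc⟩ := exists_normal_sylow_seven (m := Nat.card G / 7) (by omega)
    (Nat.mul_div_cancel' h7).symm
  obtain ⟨A, hA, hPA⟩ := exists_le_of_sylow hZ h7 P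
  have hPA' : (P : Subgroup G) = A := Subgroup.eq_of_le_of_card_ge hPA (by
    rw [hPc]; exact hle A hA)
  obtain ⟨a, ha, ha1⟩ := (Subgroup.bot_or_exists_ne_one (P : Subgroup G)).resolve_left
    (P.ne_bot_of_dvd_card h7)
  refine ⟨P, hnorm, hPc, le_antisymm (fun c hc => ?_) fun c hc => ?_, fun e => ?_⟩
  · rw [hPA', h.eq_cen_of_mem hZ hA (hPA ha) ha1]
    exact mem_cen.2 (Subgroup.mem_centralizer_iff.1 hc a ha).symm
  · exact Subgroup.mem_centralizer_iff.2 fun d hd => h.commute_of_mem hA (hPA hd) (hPA hc)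
  · obtain ⟨x, hx, hx'⟩ := mem_properCentralizers.1 hA
    exact hx (cen_eq_top_iff.1 (hx' ▸ hPA' ▸ e))

end Partition

/-! ### Groups with a normal self-centralizing subgroup of order 7 -/

section SelfCentralizing

variable {G : Type*} [Group G] {A : Subgroup G}

theorem cen_eq_of_card_seven (hA7 : Nat.card A = 7)
    (hC : Subgroup.centralizer (A : Set G) = A) {a : G} (ha : a ∈ A) (ha1 : a ≠ 1) : cen a = A := by
  have : Fact (Nat.Prime 7) := ⟨by norm_num⟩
  refine le_antisymm (fun c hc => ?_) fun c hc => ?_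
  · rw [← hC]
    refine Subgroup.mem_centralizer_iff.2 fun d hd => ?_
    obtain ⟨k, hk⟩ := Subgroup.mem_zpowers_iff.1 (mem_zpowers_of_prime_card (g := (⟨a, ha⟩ : A))
      (g' := ⟨d, hd⟩) hA7 fun e => ha1 (Subtype.ext_iff.1 e))
    have hd' : a ^ k = d := Subtype.ext_iff.1 hk
    rw [← hd']
    exact (mem_cen.1 hc).symm.zpow_left k
  · rw [← hC] at hc
    exact mem_cen.2 (Subgroup.mem_centralizer_iff.1 hc a ha).symm

theorem eq_one_of_mem_of_commute (hA7 : Nat.card A = 7)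
    (hC : Subgroup.centralizer (A : Set G) = A) {x a : G} (hx : x ∉ A) (ha : a ∈ A)
    (hax : Commute a x) : a = 1 := by
  by_contra ha1
  exact hx (cen_eq_of_card_seven hA7 hC ha ha1 ▸ mem_cen.2 hax.symm)

theorem conjNormal_eq_one_iff [A.Normal] (hC : Subgroup.centralizer (A : Set G) = A) {g : G} :
    (MulAut.conjNormal g : MulAut A) = 1 ↔ g ∈ A := by
  conv_rhs => rw [← hC]
  rw [Subgroup.mem_centralizer_iff, MulEquiv.ext_iff]
  simp only [Subtype.ext_iff, MulAut.conjNormal_apply, MulAut.one_apply, Subtype.forall,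
    mul_inv_eq_iff_eq_mul, SetLike.mem_coe]
  exact forall₂_congr fun a _ => eq_comm

theorem exists_hom_units_of_card_seven [A.Normal] (hA7 : Nat.card A = 7)
    (hC : Subgroup.centralizer (A : Set G) = A) : ∃ f : G →* (ZMod 7)ˣ, ∀ g, f g = 1 ↔ g ∈ A := by
  have : Fact (Nat.Prime 7) := ⟨by norm_num⟩
  have : IsCyclic A := isCyclic_of_prime_card hA7
  have hne : Nonempty (MulAut A ≃* (ZMod (Nat.card A))ˣ) := ⟨IsCyclic.mulAutMulEquiv A⟩
  rw [hA7] at hne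
  obtain ⟨e⟩ := hne
  refine ⟨e.toMonoidHom.comp MulAut.conjNormal, fun g => ?_⟩
  rw [← conjNormal_eq_one_iff hC]
  simp

theorem HasSelfCentralizingSeven.isCyclic_cen (h : HasSelfCentralizingSeven G) {x : G}
    (hx : x ≠ 1) : IsCyclic (cen x) := by
  obtain ⟨A, hN, hA7, hC, hA⟩ := h
  have : Fact (Nat.Prime 7) := ⟨by norm_num⟩
  by_cases hxA : x ∈ A
  · rw [cen_eq_of_card_seven hA7 hC hxA hx]
    exact isCyclic_of_prime_card hA7
  · obtain ⟨f, hf⟩ := exists_hom_units_of_card_seven hA7 hC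
    refine isCyclic_of_injective (f.comp (cen x).subtype) ?_
    rw [injective_iff_map_eq_one]
    exact fun a ha => Subtype.ext
      (eq_one_of_mem_of_commute hA7 hC hxA ((hf a).1 ha) (mem_cen.1 a.2))

theorem HasSelfCentralizingSeven.center_eq_bot (h : HasSelfCentralizingSeven G) :
    Subgroup.center G = ⊥ := by
  obtain ⟨A, hN, hA7, hC, hA⟩ := h
  rw [Subgroup.eq_bot_iff_forall]
  intro z hz
  by_contra hz1
  have hzA : z ∈ A := by
    rw [← hC]
    exact Subgroup.center_le_centralizer _ hz
  exact hA ((cen_eq_of_card_seven hA7 hC hzA hz1).symm.trans (cen_eq_top_iff.2 hz))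

theorem HasSelfCentralizingSeven.not_commutative (h : HasSelfCentralizingSeven G) :
    ¬ ∀ a b : G, Commute a b := fun hc => by
  have hZ := h.center_eq_bot
  obtain ⟨A, hN, hA7, hC, hA⟩ := h
  refine hA (eq_top_iff.2 fun g _ => ?_)
  rw [Subgroup.mem_bot.1 (hZ ▸ mem_center_iff_commute.2 fun y => hc y g : g ∈ (⊥ : Subgroup G))]
  exact one_mem A

theorem HasSelfCentralizingSeven.isCAGroup (h : HasSelfCentralizingSeven G) : IsCAGroup G := by
  intro x a b hx ha hb
  have := h.isCyclic_cen (ne_one_of_notMem_center hx)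
  have := IsCyclic.isMulCommutative (α := cen x)
  exact Subtype.ext_iff.1 (mul_comm' (⟨a, mem_cen.2 ha⟩ : cen x) ⟨b, mem_cen.2 hb⟩)

variable [Finite G]

/-- Commutators with $x$ lie in $A$ because $G/A$ is abelian. On $A$ the map $a\mapsto[a,x]$ is
injective, hence onto, so any $g$ has $[g,x]=[a,x]$ for some $a\in A$, and $a^{-1}g\in C(x)$. -/
theorem isComplement_cen [A.Normal] (hA7 : Nat.card A = 7)
    (hC : Subgroup.centralizer (A : Set G) = A) {x : G} (hx : x ∉ A) :
    A.IsComplement' (cen x) := by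
  obtain ⟨f, hf⟩ := exists_hom_units_of_card_seven hA7 hC
  have hmem : ∀ g, g * x * g⁻¹ * x⁻¹ ∈ A := fun g => by
    rw [← hf]
    simp [mul_comm]
  have heq : ∀ {g h : G}, g * x * g⁻¹ * x⁻¹ = h * x * h⁻¹ * x⁻¹ → g⁻¹ * h ∈ cen x := by
    intro g h e
    rw [mul_left_inj, mul_inv_eq_iff_eq_mul] at e
    rw [mem_cen, commute_iff_eq, mul_assoc, inv_mul_eq_iff_eq_mul, ← mul_assoc, ← mul_assoc, e]
    group
  have hinj : Function.Injective (fun a : A => (⟨_, hmem a⟩ : A)) := fun a b hab => by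
    have h1 := heq (Subtype.ext_iff.1 hab)
    have h2 := eq_one_of_mem_of_commute hA7 hC hx (mul_mem (inv_mem a.2) b.2) (mem_cen.1 h1)
    exact Subtype.ext (inv_mul_eq_one.1 h2)
  refine Subgroup.isComplement'_of_disjoint_and_mul_eq_univ ?_ ?_
  · rw [Subgroup.disjoint_def]
    exact fun ha hax => eq_one_of_mem_of_commute hA7 hC hx ha (mem_cen.1 hax)
  · rw [Set.eq_univ_iff_forall]
    intro g
    obtain ⟨a, ha⟩ := Finite.surjective_of_injective hinj ⟨_, hmem g⟩
    exact ⟨a, a.2, _, heq (Subtype.ext_iff.1 ha), mul_inv_cancel_left _ _⟩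

theorem seven_mul_card_cen [A.Normal] (hA7 : Nat.card A = 7)
    (hC : Subgroup.centralizer (A : Set G) = A) {x : G} (hx : x ∉ A) :
    7 * Nat.card (cen x) = Nat.card G := by
  rw [← hA7]
  exact (isComplement_cen hA7 hC hx).card_mul_card

theorem one_lt_card_cen {x : G} (hx : x ≠ 1) : 1 < Nat.card (cen x) := by
  rw [Subgroup.one_lt_card_iff_ne_bot]
  exact fun hb => hx (Subgroup.mem_bot.1 (hb ▸ self_mem_cen x))

/-- With $c=|C(x)|$ for $x\notin A$ and $k$ proper centralizers besides $A$, the partition gives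
$6+k(c-1)=7c-1$, so $k=7$; adding $A$ and $G$ gives nine. -/
theorem HasSelfCentralizingSeven.ncard_elementCentralizers (h : HasSelfCentralizingSeven G) :
    (elementCentralizers G).ncard = 9 := by
  classical
  have hZ := h.center_eq_bot
  have hCA := h.isCAGroup
  obtain ⟨A, hN, hA7, hC, hA⟩ := h
  obtain ⟨x, hx⟩ : ∃ x, x ∉ A := by
    by_contra hc
    push Not at hc
    exact hA (eq_top_iff.2 fun g _ => hc g)
  obtain ⟨a, ha, ha1⟩ := (Subgroup.bot_or_exists_ne_one A).resolve_left (by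
    rintro rfl
    rw [Subgroup.card_bot] at hA7
    omega)
  have hAmem : A ∈ properCentralizers G :=
    cen_eq_of_card_seven hA7 hC ha ha1 ▸ cen_mem_properCentralizers hZ ha1
  have hsum := hCA.sum_card_properCentralizers hZ
  have hcx := seven_mul_card_cen hA7 hC hx
  have hm := one_lt_card_cen fun e : x = 1 => hx (e ▸ one_mem A)
  rw [← Finset.add_sum_erase _ _ hAmem, Finset.sum_const_nat (m := Nat.card (cen x) - 1),
    Finset.card_erase_of_mem hAmem, hA7] at hsum
  · rw [← card_properCentralizers_add_one]
    have hpos : 0 < (properCentralizers G).card := Finset.card_pos.2 ⟨A, hAmem⟩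
    obtain ⟨k, hk⟩ := Nat.exists_eq_add_of_lt hpos
    obtain ⟨m, hm'⟩ := Nat.exists_eq_add_of_lt hm
    rw [zero_add] at hk
    have h1 : (properCentralizers G).card - 1 = k := by omega
    have h2 : Nat.card (cen x) - 1 = m + 1 := by omega
    rw [h1, h2] at hsum
    have h3 : k * (m + 1) = 7 * (m + 1) := by omega
    have := Nat.eq_of_mul_eq_mul_right (by omega) h3
    omega
  · intro B hB
    obtain ⟨hBA, hB⟩ := Finset.mem_erase.1 hB
    obtain ⟨y, hy, rfl⟩ := mem_properCentralizers.1 hB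
    have hyA : y ∉ A := fun hyA =>
      hBA (cen_eq_of_card_seven hA7 hC hyA (ne_one_of_notMem_center hy))
    have := seven_mul_card_cen hA7 hC hyA
    omega

theorem HasSelfCentralizingSeven.isTwoNCentralizer (h : HasSelfCentralizingSeven G) :
    IsTwoNCentralizer 9 G := by
  rw [IsTwoNCentralizer, h.isCAGroup.ncard_two_of_center_eq_bot h.not_commutative h.center_eq_bot]
  exact h.ncard_elementCentralizers

omit [Finite G] in
theorem HasSelfCentralizingSeven.of_mulEquiv {H : Type*} [Group H] (e : G ≃* H)
    (h : HasSelfCentralizingSeven G) : HasSelfCentralizingSeven H := by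
  obtain ⟨A, hN, hA7, hC, hA⟩ := h
  refine ⟨A.map e.toMonoidHom, hN.map _ e.surjective, ?_, ?_, fun h => hA ?_⟩
  · rw [← hA7]
    exact (Nat.card_congr (A.equivMapOfInjective _ e.injective).toEquiv).symm
  · ext y
    obtain ⟨x, rfl⟩ := e.surjective y
    conv_rhs => rw [← hC]
    rw [Subgroup.mem_map_equiv, e.symm_apply_apply, Subgroup.mem_centralizer_iff,
      Subgroup.mem_centralizer_iff]
    constructor
    · intro hx a ha
      have := hx (e a) ⟨a, ha, rfl⟩
      rwa [← map_mul, ← map_mul, e.injective.eq_iff] at this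
    · rintro hx _ ⟨a, ha, rfl⟩
      change e a * e x = e x * e a
      rw [← map_mul, hx a ha, map_mul]
  · rw [eq_top_iff] at h ⊢
    intro g _
    have := h (Subgroup.mem_top (e g))
    rwa [Subgroup.mem_map_equiv, e.symm_apply_apply] at this

theorem hasSelfCentralizingSeven_of_card {q : ℕ} (hq : q.Prime) (hq7 : q < 7)
    (hG : Nat.card G = 7 * q) (hne : ∃ a b : G, a * b ≠ b * a) : HasSelfCentralizingSeven G := by
  obtain ⟨P, hN, hP⟩ := exists_normal_sylow_seven hq7 hG
  have : Fact (Nat.Prime 7) := ⟨by norm_num⟩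
  have := Fact.mk hq
  have hcyc : IsCyclic P := isCyclic_of_prime_card hP
  have := IsCyclic.isMulCommutative (α := P)
  have hidx : (P : Subgroup G).index = q := by
    have := (P : Subgroup G).card_mul_index
    rw [hP, hG] at this
    omega
  have hle : (P : Subgroup G) ≤ Subgroup.centralizer (P : Set G) := fun c hc =>
    Subgroup.mem_centralizer_iff.2 fun d hd => Subtype.ext_iff.1
      (mul_comm' (⟨d, hd⟩ : P) ⟨c, hc⟩)
  refine ⟨P, hN, hP, ?_, fun e => ?_⟩
  · have h1 := Subgroup.relIndex_mul_index hle
    rw [hidx] at h1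
    -- The index $q$ is prime, so $C(P)$ is $P$ or $G$; in the latter case $P$ is central with
    -- cyclic quotient and $G$ is abelian.
    rcases (Nat.dvd_prime hq).1 (Dvd.intro _ h1) with h2 | h2
    · exact le_antisymm (Subgroup.relIndex_eq_one.1 h2) hle
    · exfalso
      rw [h2] at h1
      have h3 := Subgroup.index_eq_one.1 (Nat.eq_of_mul_eq_mul_left hq.pos (h1.trans (mul_one q).symm))
      rw [Subgroup.centralizer_eq_top_iff_subset] at h3
      have : IsCyclic (G ⧸ (P : Subgroup G)) := isCyclic_of_prime_card (p := q) hidx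
      obtain ⟨a, b, hab⟩ := hne
      have := (QuotientGroup.mk' (P : Subgroup G)).isMulCommutative_of_isCyclic_of_ker_le_center
        (by rw [QuotientGroup.ker_mk']; exact h3)
      exact hab (mul_comm' a b)
  · rw [e, Subgroup.index_top] at hidx
    exact hq.one_lt.ne hidx

end SelfCentralizing

/-! ### Identification with $D_{14}$, the holomorph, and order 21 -/

section Models

theorem hasSelfCentralizingSeven_dihedralGroup : HasSelfCentralizingSeven (DihedralGroup 7) := by
  refine hasSelfCentralizingSeven_of_card Nat.prime_two (by norm_num) ?_
    ⟨DihedralGroup.r 1, DihedralGroup.sr 0, by decide⟩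
  rw [DihedralGroup.nat_card]

theorem card_multiplicative_zmod_seven : Nat.card (Multiplicative (ZMod 7)) = 7 := by
  rw [Nat.card_congr Multiplicative.toAdd, Nat.card_zmod]

theorem hasSelfCentralizingSeven_holomorph :
    HasSelfCentralizingSeven (Holomorph (Multiplicative (ZMod 7))) := by
  refine ⟨SemidirectProduct.inl.range, ?_, ?_, ?_, fun h => ?_⟩
  · rw [SemidirectProduct.range_inl_eq_ker_rightHom]
    infer_instance
  · refine Eq.trans ?_ card_multiplicative_zmod_seven
    exact (Nat.card_congr (MonoidHom.ofInjective (SemidirectProduct.inl_injective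
      (φ := MonoidHom.id (MulAut (Multiplicative (ZMod 7)))))).toEquiv).symm
  · ext x
    rw [Subgroup.mem_centralizer_iff]
    constructor
    · intro hx
      refine ⟨x.left, SemidirectProduct.ext rfl ?_⟩
      refine MulEquiv.ext fun b => ?_
      have h1 := congrArg SemidirectProduct.left (hx (SemidirectProduct.inl b) ⟨b, rfl⟩)
      simp only [SemidirectProduct.mul_left, SemidirectProduct.left_inl,
        SemidirectProduct.right_inl, MonoidHom.id_apply, MulAut.one_apply] at h1
      rw [mul_comm, mul_left_cancel_iff] at h1
      exact h1
    · rintro ⟨a, rfl⟩ _ ⟨b, rfl⟩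
      rw [← map_mul, ← map_mul, mul_comm]
  -- Inversion is a nontrivial automorphism, so the normal factor is proper.
  · have h1 : SemidirectProduct.inr (MulEquiv.inv (Multiplicative (ZMod 7))) ∈
        (SemidirectProduct.inl : _ →* Holomorph (Multiplicative (ZMod 7))).range := h ▸ trivial
    obtain ⟨a, ha⟩ := h1
    have h2 := congrArg SemidirectProduct.right ha
    simp only [SemidirectProduct.right_inl, SemidirectProduct.right_inr] at h2
    have h3 := DFunLike.congr_fun h2 (Multiplicative.ofAdd (1 : ZMod 7))
    revert h3
    decide

variable {G : Type*} [Group G] [Finite G] {A : Subgroup G}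

omit [Finite G] in
theorem exists_mulEquiv_of_card_seven (hA7 : Nat.card A = 7) :
    Nonempty (A ≃* Multiplicative (ZMod 7)) := by
  have : Fact (Nat.Prime 7) := ⟨by norm_num⟩
  have : IsCyclic A := isCyclic_of_prime_card hA7
  have : IsCyclic (Multiplicative (ZMod 7)) := isCyclic_of_prime_card card_multiplicative_zmod_seven
  exact ⟨mulEquivOfCyclicCardEq (hA7.trans card_multiplicative_zmod_seven.symm)⟩

theorem nonempty_mulEquiv_dihedralGroup [A.Normal] (hA7 : Nat.card A = 7)
    (hC : Subgroup.centralizer (A : Set G) = A) {x : G} (hx : x ∉ A)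
    (hcx : Nat.card (cen x) = 2) : Nonempty (G ≃* DihedralGroup 7) := by
  obtain ⟨e⟩ := exists_mulEquiv_of_card_seven hA7
  have hx2 : x * x = 1 := by
    have := pow_card_eq_one' (x := (⟨x, self_mem_cen x⟩ : cen x))
    rw [hcx, pow_two] at this
    exact Subtype.ext_iff.1 this
  have hinv : x⁻¹ = x := inv_eq_of_mul_eq_one_left hx2
  let α : ZMod 7 → G := fun i => (e.symm (Multiplicative.ofAdd i) : A)
  have hαA : ∀ i, α i ∈ A := fun i => (e.symm (Multiplicative.ofAdd i)).2
  have hadd : ∀ i j, α (i + j) = α i * α j := fun i j => by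
    simp only [α, ofAdd_add, map_mul, Subgroup.coe_mul]
  have hneg : ∀ i, α (-i) = (α i)⁻¹ := fun i => by
    simp only [α, ofAdd_neg, map_inv, Subgroup.coe_inv]
  have hαinj : Function.Injective α := fun i j hij =>
    Multiplicative.ofAdd.injective (e.symm.injective (Subtype.ext hij))
  have hsub : ∀ i j, α (j - i) = (α i)⁻¹ * α j := fun i j => by
    rw [sub_eq_neg_add, hadd, hneg]
  have hcommA : ∀ a ∈ A, ∀ b ∈ A, a * b = b * a := fun a ha b hb => by
    rw [← hC] at hb
    exact Subgroup.mem_centralizer_iff.1 hb a ha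
  have hconj : ∀ a ∈ A, a * x = x * a⁻¹ := by
    intro a ha
    have hxa : x * a * x ∈ A := by
      have := Subgroup.Normal.conj_mem ‹A.Normal› a ha x
      rwa [hinv] at this
    -- The product lies in the abelian group $A$ and is fixed by conjugation by $x$, so it is
    -- trivial: $x$ inverts $A$.
    have h1 : a * (x * a * x) = 1 := by
      refine eq_one_of_mem_of_commute hA7 hC hx (mul_mem ha hxa) ?_
      rw [commute_iff_eq]
      calc a * (x * a * x) * x = a * (x * a) * (x * x) := by group
        _ = x * (x * a * x * a) := by
          rw [hx2, mul_one, show x * (x * a * x * a) = (x * x) * (a * x * a) by group, hx2]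
          group
        _ = x * (a * (x * a * x)) := by rw [hcommA _ hxa a ha]
    rw [inv_eq_of_mul_eq_one_right h1, ← mul_assoc, ← mul_assoc, hx2, one_mul]
  let f : DihedralGroup 7 →* G := MonoidHom.mk' (fun d => match d with
    | DihedralGroup.r i => α i
    | DihedralGroup.sr i => x * α i) (by
      rintro (i | i) (j | j)
      · exact hadd i j
      · change x * α (j - i) = α i * (x * α j)
        rw [hsub, ← mul_assoc, ← mul_assoc, hconj _ (hαA i)]
      · change x * α (i + j) = x * α i * α j
        rw [hadd, mul_assoc]
      · change α (j - i) = x * α i * (x * α j)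
        rw [hsub, mul_assoc, ← mul_assoc (α i), hconj _ (hαA i), mul_assoc, ← mul_assoc, hx2,
          one_mul])
  have hfinj : Function.Injective f := by
    rintro (i | i) (j | j) hij
    · exact congrArg _ (hαinj hij)
    · change α i = x * α j at hij
      exact absurd (hij ▸ hαA i) fun h => hx ((A.mul_mem_cancel_right (hαA j)).1 h)
    · change x * α i = α j at hij
      exact absurd (hij ▸ hαA j) fun h => hx ((A.mul_mem_cancel_right (hαA i)).1 h)
    · exact congrArg _ (hαinj (mul_left_cancel hij))
  have hcard : Nat.card G ≤ Nat.card (DihedralGroup 7) := by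
    rw [DihedralGroup.nat_card, ← seven_mul_card_cen hA7 hC hx, hcx]
  exact ⟨(MulEquiv.ofBijective f (hfinj.bijective_of_nat_card_le hcard)).symm⟩

/-- Conjugation embeds $C(x)$ in $\mathrm{Aut}(A)$, which also has order 6, so the complement is all
of $\mathrm{Aut}(A)$ with its natural action. -/
theorem nonempty_mulEquiv_holomorph [A.Normal] (hA7 : Nat.card A = 7)
    (hC : Subgroup.centralizer (A : Set G) = A) {x : G} (hx : x ∉ A)
    (hcx : Nat.card (cen x) = 6) : Nonempty (G ≃* Holomorph (Multiplicative (ZMod 7))) := by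
  obtain ⟨e⟩ := exists_mulEquiv_of_card_seven hA7
  have : Fact (Nat.Prime 7) := ⟨by norm_num⟩
  have : IsCyclic A := isCyclic_of_prime_card hA7
  have hcomp := isComplement_cen hA7 hC hx
  set ψ : cen x →* MulAut A := (A.normalizerMonoidHom).comp
    (Subgroup.inclusion (A.normalizer_eq_top ▸ le_top)) with hψ
  have hψinj : Function.Injective ψ := by
    rw [injective_iff_map_eq_one]
    intro c hc
    refine Subtype.ext (eq_one_of_mem_of_commute hA7 hC hx ?_ (mem_cen.1 c.2))
    rw [← conjNormal_eq_one_iff hC]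
    exact hc
  have hcard : Nat.card (MulAut A) ≤ Nat.card (cen x) := by
    rw [IsCyclic.card_mulAut, hA7, hcx]
    decide
  let ψe : cen x ≃* MulAut A := MulEquiv.ofBijective ψ (hψinj.bijective_of_nat_card_le hcard)
  refine ⟨(SemidirectProduct.mulEquivSubgroup hcomp).symm.trans
    (SemidirectProduct.congr e (ψe.trans (MulAut.congr e)) fun g => ?_)⟩
  ext a
  simp [ψe, MulAut.congr]
  rfl

theorem hasSelfCentralizingSeven_iff : HasSelfCentralizingSeven G ↔
    Nonempty (G ≃* DihedralGroup 7) ∨ Nonempty (G ≃* Holomorph (Multiplicative (ZMod 7))) ∨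
      IsNonabelianOfOrder 21 G := by
  constructor
  · intro h
    have hne := h.not_commutative
    obtain ⟨A, hN, hA7, hC, hA⟩ := h
    obtain ⟨x, hx⟩ : ∃ x, x ∉ A := by
      by_contra hc
      push Not at hc
      exact hA (eq_top_iff.2 fun g _ => hc g)
    have hm := one_lt_card_cen fun e : x = 1 => hx (e ▸ one_mem A)
    have hcx := seven_mul_card_cen hA7 hC hx
    obtain ⟨f, hf⟩ := exists_hom_units_of_card_seven hA7 hC
    have hd : Nat.card (cen x) ∣ 6 := by
      have hinj : Function.Injective (f.comp (cen x).subtype) := by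
        rw [injective_iff_map_eq_one]
        exact fun a ha => Subtype.ext
          (eq_one_of_mem_of_commute hA7 hC hx ((hf a).1 ha) (mem_cen.1 a.2))
      have := Subgroup.card_dvd_of_injective _ hinj
      rwa [Nat.card_eq_fintype_card (α := (ZMod 7)ˣ), ZMod.card_units_eq_totient,
        show Nat.totient 7 = 6 by decide] at this
    have hle := Nat.le_of_dvd (by norm_num) hd
    have hcases : Nat.card (cen x) = 2 ∨ Nat.card (cen x) = 3 ∨ Nat.card (cen x) = 6 := by
      generalize Nat.card (cen x) = c at *
      interval_cases c <;> omega
    rcases hcases with h2 | h3 | h6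
    · exact Or.inl (nonempty_mulEquiv_dihedralGroup hA7 hC hx h2)
    · refine Or.inr (Or.inr ⟨by omega, ?_⟩)
      push Not at hne
      exact hne
    · exact Or.inr (Or.inl (nonempty_mulEquiv_holomorph hA7 hC hx h6))
  · rintro (⟨⟨e⟩⟩ | ⟨⟨e⟩⟩ | ⟨hc, hne⟩)
    · exact hasSelfCentralizingSeven_dihedralGroup.of_mulEquiv e.symm
    · exact hasSelfCentralizingSeven_holomorph.of_mulEquiv e.symm
    · exact hasSelfCentralizingSeven_of_card Nat.prime_three (by norm_num) hc hne

end Models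

/-! ### Centralizers in $G$ and in $G/Z(G)$ -/

section CentralQuotient

variable {G : Type*} [Group G]

theorem mk_eq_one_iff_mem_center {g : G} :
    (g : G ⧸ Subgroup.center G) = 1 ↔ g ∈ Subgroup.center G := QuotientGroup.eq_one_iff g

/-- If every proper centralizer of `G ⧸ Z(G)` is cyclic, then the centralizers of `G` are the
preimages of those of `G ⧸ Z(G)`. -/
theorem cen_eq_comap_of_isCyclic (h : ∀ x : G ⧸ Subgroup.center G, x ≠ 1 → IsCyclic (cen x))
    (w : G) : cen w = (cen (w : G ⧸ Subgroup.center G)).comap (QuotientGroup.mk' _) := by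
  by_cases hw : w ∈ Subgroup.center G
  · rw [cen_eq_top_iff.2 hw, mk_eq_one_iff_mem_center.2 hw, cen_eq_top_iff.2 (one_mem _),
      Subgroup.comap_top]
  · have hcyc := h w fun e => hw (mk_eq_one_iff_mem_center.1 e)
    ext c
    rw [Subgroup.mem_comap, mem_cen, mem_cen]
    refine ⟨fun hc => hc.map (QuotientGroup.mk' _), fun hc => ?_⟩
    obtain ⟨⟨v, hv⟩, hgen⟩ := IsCyclic.exists_generator (α := cen (w : G ⧸ Subgroup.center G))
    obtain ⟨v, rfl⟩ := QuotientGroup.mk_surjective v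
    -- Modulo the center, $c$ and $w$ are both powers of the lift $v$ of a generator, so they
    -- commute in $G$.
    have key : ∀ d : G, (d : G ⧸ Subgroup.center G) ∈ cen (w : G ⧸ Subgroup.center G) →
        ∃ k : ℤ, (v ^ k)⁻¹ * d ∈ Subgroup.center G := by
      intro d hd
      obtain ⟨k, hk⟩ := Subgroup.mem_zpowers_iff.1 (hgen ⟨d, hd⟩)
      refine ⟨k, mk_eq_one_iff_mem_center.1 ?_⟩
      have hk' : (v : G ⧸ Subgroup.center G) ^ k = d := Subtype.ext_iff.1 hk
      rw [QuotientGroup.mk_mul, QuotientGroup.mk_inv, QuotientGroup.mk_zpow, hk', inv_mul_cancel]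
    obtain ⟨i, hi⟩ := key c (mem_cen.2 hc)
    obtain ⟨j, hj⟩ := key w (self_mem_cen _)
    rw [mem_center_iff_commute] at hi hj
    have h1 : Commute (v ^ i * ((v ^ i)⁻¹ * c)) (v ^ j * ((v ^ j)⁻¹ * w)) :=
      (((Commute.refl v).zpow_zpow i j).mul_right (hj _)).mul_left (hi _).symm
    rwa [mul_inv_cancel_left, mul_inv_cancel_left] at h1

theorem ncard_elementCentralizers_eq_of_isCyclic
    (h : ∀ x : G ⧸ Subgroup.center G, x ≠ 1 → IsCyclic (cen x)) :
    (elementCentralizers G).ncard = (elementCentralizers (G ⧸ Subgroup.center G)).ncard := by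
  rw [← Set.ncard_image_of_injective (elementCentralizers (G ⧸ Subgroup.center G))
    (Subgroup.comap_injective (QuotientGroup.mk'_surjective (Subgroup.center G)))]
  congr 1
  ext H
  constructor
  · rintro ⟨w, rfl⟩
    exact ⟨_, cen_mem_elementCentralizers (w : G ⧸ Subgroup.center G),
      (cen_eq_comap_of_isCyclic h w).symm⟩
  · rintro ⟨_, ⟨x, rfl⟩, rfl⟩
    obtain ⟨w, rfl⟩ := QuotientGroup.mk_surjective x
    exact ⟨w, (cen_eq_comap_of_isCyclic h w).symm⟩

/-- Lifting a representative of each proper centralizer of $G/Z$ gives an injection into those of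
$G$; equal counts make it a bijection, so $C_G(w)$ depends only on $C_{G/Z}(wZ)$ when $wZ$ is
noncentral. If $zZ$ is central, $w$ and $wz$ then have the same centralizer, so $z$ commutes with
$w$. -/
theorem center_quotient_eq_bot_of_ncard_eq [Finite G] (hCA : IsCAGroup (G ⧸ Subgroup.center G))
    (hne : ¬ ∀ a b : G ⧸ Subgroup.center G, Commute a b)
    (hcard : (elementCentralizers G).ncard =
      (elementCentralizers (G ⧸ Subgroup.center G)).ncard) :
    Subgroup.center (G ⧸ Subgroup.center G) = ⊥ := by
  have hrep : ∀ B : properCentralizers (G ⧸ Subgroup.center G), ∃ w : G,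
      (w : G ⧸ Subgroup.center G) ∉ Subgroup.center (G ⧸ Subgroup.center G) ∧ (B : Subgroup _) =
        cen (w : G ⧸ Subgroup.center G) := by
    intro B
    obtain ⟨x, hx, hB⟩ := mem_properCentralizers.1 B.2
    obtain ⟨w, rfl⟩ := QuotientGroup.mk_surjective x
    exact ⟨w, hx, hB⟩
  choose r hr hBr using hrep
  have hnc : ∀ w : G, (w : G ⧸ Subgroup.center G) ∉ Subgroup.center (G ⧸ Subgroup.center G) →
      w ∉ Subgroup.center G := fun w hw hc => hw (by
    rw [mk_eq_one_iff_mem_center.2 hc]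
    exact one_mem _)
  have hcomm : ∀ B (w : G), (w : G ⧸ Subgroup.center G) ∉
      Subgroup.center (G ⧸ Subgroup.center G) → cen (r B) = cen w →
      (B : Subgroup (G ⧸ Subgroup.center G)) = cen (w : G ⧸ Subgroup.center G) := by
    intro B w hw he
    rw [hBr]
    refine hCA.cen_eq (hr B) hw ?_
    exact (mem_cen.1 (he ▸ self_mem_cen (r B) : r B ∈ cen w)).map (QuotientGroup.mk' _)
  have hinj : Function.Injective (fun B : properCentralizers (G ⧸ Subgroup.center G) =>
      (⟨cen (r B), mem_properCentralizers.2 ⟨r B, hnc _ (hr B), rfl⟩⟩ : properCentralizers G)) := by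
    intro B C h
    refine Subtype.ext ?_
    rw [hcomm B (r C) (hr C) (Subtype.ext_iff.1 h), hBr C]
  have hsurj := (hinj.bijective_of_nat_card_le (by
    rw [Nat.card_eq_finsetCard, Nat.card_eq_finsetCard]
    have h1 := card_properCentralizers_add_one (G := G)
    have h2 := card_properCentralizers_add_one (G := G ⧸ Subgroup.center G)
    omega)).2
  have hdet : ∀ w w' : G, (w : G ⧸ Subgroup.center G) ∉ Subgroup.center (G ⧸ Subgroup.center G) →
      (w' : G ⧸ Subgroup.center G) ∉ Subgroup.center (G ⧸ Subgroup.center G) →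
      cen (w : G ⧸ Subgroup.center G) = cen (w' : G ⧸ Subgroup.center G) → cen w = cen w' := by
    intro w w' hw hw' he
    obtain ⟨B, hB⟩ := hsurj ⟨cen w, mem_properCentralizers.2 ⟨w, hnc w hw, rfl⟩⟩
    obtain ⟨C, hC⟩ := hsurj ⟨cen w', mem_properCentralizers.2 ⟨w', hnc w' hw', rfl⟩⟩
    have hB' : cen (r B) = cen w := Subtype.ext_iff.1 hB
    have hC' : cen (r C) = cen w' := Subtype.ext_iff.1 hC
    have hBC : B = C := Subtype.ext (by rw [hcomm B w hw hB', hcomm C w' hw' hC', he])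
    rw [← hB', ← hC', hBC]
  rw [Subgroup.eq_bot_iff_forall]
  intro z hz
  obtain ⟨z, rfl⟩ := QuotientGroup.mk_surjective z
  have hzc : ∀ w : G, (w : G ⧸ Subgroup.center G) ∉ Subgroup.center (G ⧸ Subgroup.center G) →
      Commute w z := by
    intro w hw
    have hwz : ((w * z : G) : G ⧸ Subgroup.center G) ∉
        Subgroup.center (G ⧸ Subgroup.center G) := fun h => hw <| by
      rw [QuotientGroup.mk_mul] at h
      exact (Subgroup.mul_mem_cancel_right _ hz).1 h
    have he := hdet (w * z) w hwz hw (hCA.cen_eq hwz hw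
      (by
        rw [QuotientGroup.mk_mul]
        exact (Commute.refl _).mul_left (mem_center_iff_commute.1 hz _).symm))
    have h1 : Commute (w * z) w := mem_cen.1 (he ▸ self_mem_cen (w * z))
    have h2 := (Commute.refl w).inv_left.mul_left h1
    rw [inv_mul_cancel_left] at h2
    exact h2.symm
  obtain ⟨x, hx⟩ := exists_notMem_center hne
  obtain ⟨w, rfl⟩ := QuotientGroup.mk_surjective x
  rw [mk_eq_one_iff_mem_center, mem_center_iff_commute]
  intro g
  -- If $gZ$ is central, write $g=(gw)w^{-1}$ with $wZ$ noncentral; both $gw$ and $w$ commute with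
  -- $z$.
  by_cases hg : (g : G ⧸ Subgroup.center G) ∈ Subgroup.center (G ⧸ Subgroup.center G)
  · have h1 := hzc (g * w) fun h => hx <| by
      rw [QuotientGroup.mk_mul] at h
      exact (Subgroup.mul_mem_cancel_left _ hg).1 h
    have h2 := h1.mul_left (hzc w hx).inv_left
    rwa [mul_inv_cancel_right] at h2
  · exact hzc g hg

end CentralQuotient

/-! ### Assembly of the classification -/

section Main

variable {G : Type*} [Group G] [Finite G]

theorem isTwoNCentralizer_nine_iff : IsTwoNCentralizer 9 G ↔
    HasSelfCentralizingSeven G ∨ (IsNCentralizer 8 G ∧ Subgroup.center G ≠ ⊥) := by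
  constructor
  · intro h
    rw [IsTwoNCentralizer] at h
    have hne : ¬ ∀ a b : G, Commute a b := fun hc => by
      have := ncard_twoElementCentralizers_le_one hc
      omega
    have hCA : IsCAGroup G := by
      by_contra hc
      have h1 := ten_le_ncard_of_not_isCAGroup hc
      have h2 := ncard_elementCentralizers_le hne
      omega
    by_cases hZ : Subgroup.center G = ⊥
    · exact Or.inl (hCA.hasSelfCentralizingSeven hZ
        ((hCA.ncard_two_of_center_eq_bot hne hZ).symm.trans h))
    · refine Or.inr ⟨?_, hZ⟩
      have := hCA.ncard_two_of_center_ne_bot hne hZ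
      rw [IsNCentralizer]
      omega
  · rintro (h | ⟨h, hZ⟩)
    · exact h.isTwoNCentralizer
    · rw [IsNCentralizer] at h
      have hne : ¬ ∀ a b : G, Commute a b := fun hc => by
        have := ncard_elementCentralizers_le_one hc
        omega
      have hCA : IsCAGroup G := by
        by_contra hc
        have h1 := ten_le_ncard_of_not_isCAGroup hc
        omega
      rw [IsTwoNCentralizer, hCA.ncard_two_of_center_ne_bot hne hZ, h]

theorem isPrimitiveTwoNCentralizer_nine_iff :
    IsPrimitiveTwoNCentralizer 9 G ↔ HasSelfCentralizingSeven G := by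
  constructor
  · rintro ⟨h, hQ⟩
    rcases isTwoNCentralizer_nine_iff.1 h with h | ⟨h, -⟩
    · exact h
    exfalso
    rw [IsNCentralizer] at h
    rcases isTwoNCentralizer_nine_iff.1 hQ with hQ | ⟨hQ, hZ⟩
    · have h1 := ncard_elementCentralizers_eq_of_isCyclic fun x hx => hQ.isCyclic_cen hx
      rw [h, hQ.ncard_elementCentralizers] at h1
      omega
    · rw [IsNCentralizer] at hQ
      refine hZ (center_quotient_eq_bot_of_ncard_eq ?_ (fun hc => ?_) (h.trans hQ.symm))
      · by_contra hc
        have := ten_le_ncard_of_not_isCAGroup hc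
        omega
      · have := ncard_elementCentralizers_le_one hc
        omega
  · intro h
    refine ⟨h.isTwoNCentralizer, HasSelfCentralizingSeven.isTwoNCentralizer ?_⟩
    exact h.of_mulEquiv ((QuotientGroup.quotientMulEquivOfEq h.center_eq_bot).trans
      QuotientGroup.quotientBot).symm

end Main

theorem mainTheorem1 {G : Type*} [Group G] [Finite G] :
    (IsTwoNCentralizer 9 G ↔
      Nonempty (G ≃* DihedralGroup 7) ∨
      Nonempty (G ≃* Holomorph (Multiplicative (ZMod 7))) ∨
      IsNonabelianOfOrder 21 G ∨
      (IsNCentralizer 8 G ∧ Subgroup.center G ≠ ⊥)) ∧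
    (IsPrimitiveTwoNCentralizer 9 G ↔
      Nonempty (G ≃* DihedralGroup 7) ∨
      Nonempty (G ≃* Holomorph (Multiplicative (ZMod 7))) ∨
      IsNonabelianOfOrder 21 G) := by
  refine ⟨?_, ?_⟩
  · rw [isTwoNCentralizer_nine_iff, hasSelfCentralizingSeven_iff, or_assoc, or_assoc]
  · rw [isPrimitiveTwoNCentralizer_nine_iff, hasSelfCentralizingSeven_iff]
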